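/- The separable permutations are those which can be built from the permutation $1$ of length one by repeatedly applying the direct sum $\oplus$ and the skew sum $\ominus$ (so they are non-empty). A non-empty permutation $\pi_1\cdots\pi_n$ is irreducible if there is no $i$, $2\le i\le n$, such that every element of $\pi_1\cdots\pi_{i-1}$ is less than every element of $\pi_i\cdots\pi_n$, and it is reducible otherwise. Let $\mathrm{lmax}(\pi)$, $\mathrm{rmax}(\pi)$, $\mathrm{lmin}(\pi)$, $\mathrm{rmin}(\pi)$ denote the numbers of left-to-right maxima, right-to-left maxima, left-to-right minima and right-to-left minima of $\pi$, and let $|\pi|$ be its length. Let $K$ be a field of characteristic $0$ and let $z,z_1,z_2,z_3\in K$ (for instance, indeterminates in a field of rational functions over $\mathbb{Q}$). All identities below are between Laurent series in $t$ over $K$, and square roots are the power series square roots with constant term $1$. Let $$S(t,z)=\frac{4\sqrt{\left(-\frac14\sqrt{t^2-6t+1}-tz+\frac t4+\frac54\right)^2+\sqrt{t^2-6t+1}-t-1}-\sqrt{t^2-6t+1}+4tz+t-3}{2\left(\sqrt{t^2-6t+1}-t-1\right)},$$ $$E(t,z_1,z_2,z_3)=z_1z_2z_3t+\frac{(S(t,z_1)+1)(S(t,z_2)+1)(S(t,z_3)+1)t^2z_1^2z_2z_3}{(1-S(t,z_1)S(t,z_3))(1-S(t,z_1)S(t,z_2))},$$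 $$A(z_2,z_3)=S(t,z_2)\left(z_3t+\frac{S(t,z_3)^2}{S(t,z_3)+1}\right).$$ Then $S(t,z)=\sum_\pi t^{|\pi|}z^{\mathrm{stat}(\pi)}$, summed over all separable permutations, for each $\mathrm{stat}\in\{\mathrm{lmax},\mathrm{rmax},\mathrm{lmin},\mathrm{rmin}\}$, and the following hold. (1) For each triple $(\mathrm{stat}_1,\mathrm{stat}_2,\mathrm{stat}_3)$ in $$\{(\mathrm{lmax},\mathrm{rmax},\mathrm{lmin}),(\mathrm{lmin},\mathrm{rmin},\mathrm{lmax}),(\mathrm{rmin},\mathrm{rmax},\mathrm{lmin}),(\mathrm{rmax},\mathrm{rmin},\mathrm{lmax})\},$$ the generating function $\sum_\pi t^{|\pi|}z_1^{\mathrm{stat}_1(\pi)}z_2^{\mathrm{stat}_2(\pi)}z_3^{\mathrm{stat}_3(\pi)}$ over all separable permutations is $$\frac{E(t,z_1,z_2,z_3)}{1-A(z_2,z_3)-tz_2z_3}.$$ (2) For each triple in $\{(\mathrm{lmax},\mathrm{rmax},\mathrm{lmin}),(\mathrm{rmin},\mathrm{rmax},\mathrm{lmin})\}$, the corresponding generating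 function over reducible separable permutations is $E(t,z_1,z_2,z_3)-z_1z_2z_3t$, and over irreducible separable permutations it is $$\frac{1}{1-A(z_2,z_3)-tz_2z_3}\Bigl(z_1z_2z_3t+(A(z_2,z_3)+tz_2z_3)\bigl(E(t,z_1,z_2,z_3)-z_1z_2z_3t\bigr)\Bigr).$$ (3) For each triple in $\{(\mathrm{lmin},\mathrm{rmin},\mathrm{lmax}),(\mathrm{rmax},\mathrm{rmin},\mathrm{lmax})\}$, the corresponding generating function over irreducible separable permutations is $E(t,z_1,z_2,z_3)$, and over reducible separable permutations it is $$-z_1z_2z_3t+\frac{1}{1-A(z_2,z_3)-tz_2z_3}\Bigl(z_1z_2z_3t+(A(z_2,z_3)+tz_2z_3)\bigl(E(t,z_1,z_2,z_3)-z_1z_2z_3t\bigr)\Bigr).$$ -/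

import Mathlib

namespace SepPerm

open scoped PowerSeries LaurentSeries

/-- The direct sum `π ⊕ σ`: a copy of `π` followed by a copy of `σ` shifted up by `m`. -/
def directSum {m n : ℕ} (π : Equiv.Perm (Fin m)) (σ : Equiv.Perm (Fin n)) :
    Equiv.Perm (Fin (m + n)) :=
  finSumFinEquiv.symm.trans ((Equiv.sumCongr π σ).trans finSumFinEquiv)

/-- The skew sum `π ⊖ σ`: a copy of `π` shifted up by `n`, followed by a copy of `σ`. -/
def skewSum {m n : ℕ} (π : Equiv.Perm (Fin m)) (σ : Equiv.Perm (Fin n)) :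
    Equiv.Perm (Fin (m + n)) :=
  finSumFinEquiv.symm.trans ((Equiv.sumCongr π σ).trans
    ((Equiv.sumComm (Fin m) (Fin n)).trans (finSumFinEquiv.trans (finCongr (Nat.add_comm n m)))))

/-- Separable permutations: those which can be built from the permutation of length `1` by
repeatedly applying direct and skew sums. In particular they have positive length. -/
inductive Separable : ∀ n : ℕ, Equiv.Perm (Fin n) → Prop
  | one : Separable 1 1
  | directSum {m n : ℕ} {π : Equiv.Perm (Fin m)} {σ : Equiv.Perm (Fin n)} :
      Separable m π → Separable n σ → Separable (m + n) (directSum π σ)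
  | skewSum {m n : ℕ} {π : Equiv.Perm (Fin m)} {σ : Equiv.Perm (Fin n)} :
      Separable m π → Separable n σ → Separable (m + n) (skewSum π σ)

/-- A nonempty permutation is irreducible if it cannot be cut into two nonempty consecutive parts
such that every element of the first part is smaller than every element of the second part. -/
def Irreducible (n : ℕ) (π : Equiv.Perm (Fin n)) : Prop :=
  0 < n ∧ ¬ ∃ k : ℕ, 0 < k ∧ k < n ∧
    ∀ a b : Fin n, (a : ℕ) < k → k ≤ (b : ℕ) → π a < π b

/-- A nonempty permutation is reducible if it is not irreducible. -/
def Reducible (n : ℕ) (π : Equiv.Perm (Fin n)) : Prop :=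
  0 < n ∧ ¬ Irreducible n π

/-- Irreducible separable permutations. -/
def IrrSeparable (n : ℕ) (π : Equiv.Perm (Fin n)) : Prop := Separable n π ∧ Irreducible n π

/-- Reducible separable permutations. -/
def RedSeparable (n : ℕ) (π : Equiv.Perm (Fin n)) : Prop := Separable n π ∧ Reducible n π

/-- A permutation statistic. -/
abbrev Stat : Type := ∀ n : ℕ, Equiv.Perm (Fin n) → ℕ

/-- The number of left-to-right maxima. -/
def lmax : Stat := fun n π => (Finset.univ.filter fun i : Fin n => ∀ j, j < i → π j < π i).card

/-- The number of right-to-left maxima. -/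
def rmax : Stat := fun n π => (Finset.univ.filter fun i : Fin n => ∀ j, i < j → π j < π i).card

/-- The number of left-to-right minima. -/
def lmin : Stat := fun n π => (Finset.univ.filter fun i : Fin n => ∀ j, j < i → π i < π j).card

/-- The number of right-to-left minima. -/
def rmin : Stat := fun n π => (Finset.univ.filter fun i : Fin n => ∀ j, i < j → π i < π j).card

section Series

variable {K : Type*} [Field K]

open Classical in
/-- The generating function `∑ t^|π| z ^ s(π)` over the permutations `π` in the class `P`,
as a formal power series in `t`. -/
noncomputable def gf₁ (P : ∀ n : ℕ, Equiv.Perm (Fin n) → Prop) (s : Stat) (z : K) : K⟦X⟧ :=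
  PowerSeries.mk fun n => ∑ π : Equiv.Perm (Fin n) with P n π, z ^ s n π

open Classical in
/-- The generating function `∑ t^|π| z₁ ^ s₁(π) z₂ ^ s₂(π) z₃ ^ s₃(π)` over the permutations `π`
in the class `P`, as a formal power series in `t`. -/
noncomputable def gf₃ (P : ∀ n : ℕ, Equiv.Perm (Fin n) → Prop) (s₁ s₂ s₃ : Stat)
    (z₁ z₂ z₃ : K) : K⟦X⟧ :=
  PowerSeries.mk fun n =>
    ∑ π : Equiv.Perm (Fin n) with P n π, z₁ ^ s₁ n π * z₂ ^ s₂ n π * z₃ ^ s₃ n π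

/-- The coefficients of the square root with constant term `1` of a power series with
constant term `1`. -/
noncomputable def sqrtCoeff (f : K⟦X⟧) : ℕ → K
  | 0 => 1
  | n + 1 => (PowerSeries.coeff (n + 1) f
      - ∑ i : Fin n, sqrtCoeff f ((i : ℕ) + 1) * sqrtCoeff f (n - (i : ℕ))) / 2
decreasing_by
  all_goals omega

/-- The square root with constant term `1` of a power series with constant term `1`. -/
noncomputable def sqrt (f : K⟦X⟧) : K⟦X⟧ := PowerSeries.mk (sqrtCoeff f)

theorem constantCoeff_sqrt (f : K⟦X⟧) : PowerSeries.constantCoeff (sqrt f) = 1 := by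
  rw [← PowerSeries.coeff_zero_eq_constantCoeff_apply, sqrt, PowerSeries.coeff_mk, sqrtCoeff]

theorem sqrt_sq [CharZero K] (f : K⟦X⟧) (hf : PowerSeries.constantCoeff f = 1) :
    sqrt f ^ 2 = f := by
  ext n
  rw [sq, PowerSeries.coeff_mul, Finset.Nat.sum_antidiagonal_eq_sum_range_succ_mk]
  simp only [sqrt, PowerSeries.coeff_mk]
  cases n with
  | zero =>
    rw [PowerSeries.coeff_zero_eq_constantCoeff_apply, hf]
    simp [sqrtCoeff]
  | succ n =>
    rw [Finset.sum_range_succ, Finset.sum_range_succ']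
    have h : sqrtCoeff f (n + 1) = (PowerSeries.coeff (n + 1) f
      - ∑ i ∈ Finset.range n, sqrtCoeff f (i + 1) * sqrtCoeff f (n - i)) / 2 := by
      rw [sqrtCoeff, Finset.sum_range (fun i => sqrtCoeff f (i + 1) * sqrtCoeff f (n - i))]
    have h0 : sqrtCoeff f 0 = 1 := by rw [sqrtCoeff]
    simp only [Nat.add_sub_add_right, Nat.sub_zero, Nat.sub_self, h0]
    rw [h]
    ring

/-- The variable `t`, as a Laurent series. -/
noncomputable def t : K⸨X⸩ := ((PowerSeries.X : K⟦X⟧) : K⸨X⸩)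

/-- An element `z` of `K`, as a constant Laurent series in `t`. -/
noncomputable def c (z : K) : K⸨X⸩ := ((PowerSeries.C z : K⟦X⟧) : K⸨X⸩)

/-- The power series `√(t² - 6t + 1)`. -/
noncomputable def r : K⟦X⟧ := sqrt (PowerSeries.X ^ 2 - 6 * PowerSeries.X + 1)

/-- The power series `√((-¼√(t² - 6t + 1) - tz + t/4 + 5/4)² + √(t² - 6t + 1) - t - 1)`; the
radicand has constant term `1`. -/
noncomputable def q (z : K) : K⟦X⟧ :=
  sqrt ((-PowerSeries.C (1 / 4) * r - PowerSeries.X * PowerSeries.C z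
    + PowerSeries.C (1 / 4) * PowerSeries.X + PowerSeries.C (5 / 4)) ^ 2
    + r - PowerSeries.X - 1)

/-- The explicit function `S(t,z)`, the quotient being taken in the field of Laurent series. -/
noncomputable def S (z : K) : K⸨X⸩ :=
  (4 * (q z : K⸨X⸩) - ((r : K⟦X⟧) : K⸨X⸩) + 4 * t * c z + t - 3) / (2 * (((r : K⟦X⟧) : K⸨X⸩) - t - 1))

/-- The function `E(t,z₁,z₂,z₃)`. -/
noncomputable def E (z₁ z₂ z₃ : K) : K⸨X⸩ :=
  c z₁ * c z₂ * c z₃ * t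
    + ((S z₁ + 1) * (S z₂ + 1) * (S z₃ + 1) * t ^ 2 * c z₁ ^ 2 * c z₂ * c z₃)
      / ((1 - S z₁ * S z₃) * (1 - S z₁ * S z₂))

/-- The function `A(z₂,z₃)`. -/
noncomputable def A (z₂ z₃ : K) : K⸨X⸩ :=
  S z₂ * (c z₃ * t + S z₃ ^ 2 / (S z₃ + 1))

end Series

end SepPerm

/-! A cut of a permutation is the same as a decomposition as a direct sum, and a cut of its
complement is a decomposition as a skew sum. A separable permutation of length greater than one has
exactly one of the two kinds. Cutting at the first possible place writes a reducible separable
permutation uniquely as (irreducible) ⊕ (separable), and complementation gives the same for skew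
sums.

Let F, R, I, Q, J be the series, weighted by (lmax, rmax, lmin), of all separable permutations, the
reducible ones, the irreducible ones, the skew sums, and those that are not skew sums. Since lmax
adds under ⊕ while rmax and lmin are read off one summand, and rmax and lmin add under ⊖ while lmax
is read off the left one: R(z₁,z₂,z₃) = I(z₁,1,z₃) F(z₁,z₂,1), Q(z₁,z₂,z₃) = J(z₁,z₂,z₃) F(1,z₂,z₃),
F = R + I, I = z₁z₂z₃t + Q, J = z₁z₂z₃t + R.

With all zᵢ = 1 this is a quadratic for I, which explains the inner root `r`; with only z₂ free it
is a quadratic for F, which explains `q` and `S`. The other specialisations are then linear, and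
`E_eq`, `A_add_eq` identify E = J(z₁,z₂,z₃) and A + tz₂z₃ = J(1,z₂,z₃), so that F = J(1 +
F(1,z₂,z₃)) = E/(1 - A - tz₂z₃).

The remaining triples follow from inversion (lmax ↔ rmin, rmax and lmin fixed) and complementation
(max ↔ min, ⊕ ↔ ⊖). -/

namespace SepPerm

open scoped PowerSeries LaurentSeries

/-- The complement of a permutation, which exchanges direct and skew sums. -/
def comp {n : ℕ} (π : Equiv.Perm (Fin n)) : Equiv.Perm (Fin n) := π.trans Fin.revPerm

/-- A permutation as a function on `ℕ`, extended by the identity. -/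
def natFun {n : ℕ} (π : Equiv.Perm (Fin n)) (i : ℕ) : ℕ :=
  if h : i < n then (π ⟨i, h⟩ : ℕ) else i

/-- `k` cuts `π` into two nonempty parts, the first below the second. -/
def IsCut {n : ℕ} (π : Equiv.Perm (Fin n)) (k : ℕ) : Prop :=
  0 < k ∧ k < n ∧ ∀ a b : Fin n, (a : ℕ) < k → k ≤ (b : ℕ) → π a < π b

@[simp] theorem comp_apply {n : ℕ} (π : Equiv.Perm (Fin n)) (i : Fin n) :
    comp π i = Fin.rev (π i) := rfl

@[simp] theorem comp_comp {n : ℕ} (π : Equiv.Perm (Fin n)) : comp (comp π) = π := by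
  ext i; simp

theorem natFun_val {n : ℕ} (π : Equiv.Perm (Fin n)) (i : Fin n) : natFun π i = π i := by
  simp [natFun]

theorem natFun_lt {n : ℕ} (π : Equiv.Perm (Fin n)) {i : ℕ} (h : i < n) : natFun π i < n := by
  simp [natFun, h]

theorem natFun_of_le {n : ℕ} (π : Equiv.Perm (Fin n)) {i : ℕ} (h : n ≤ i) : natFun π i = i := by
  simp [natFun, h]

theorem natFun_injective {n : ℕ} {π σ : Equiv.Perm (Fin n)}
    (h : ∀ i, i < n → natFun π i = natFun σ i) : π = σ := by
  ext i
  rw [← natFun_val, ← natFun_val, h i i.2]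

/-! ### Direct sums, skew sums and cuts. -/

section Sums

variable {m n : ℕ} (π : Equiv.Perm (Fin m)) (σ : Equiv.Perm (Fin n))

@[simp] theorem directSum_castAdd (i : Fin m) :
    directSum π σ (Fin.castAdd n i) = Fin.castAdd n (π i) := by
  simp [directSum]

@[simp] theorem directSum_natAdd (i : Fin n) :
    directSum π σ (Fin.natAdd m i) = Fin.natAdd m (σ i) := by
  simp [directSum]

theorem skewSum_eq_comp : skewSum π σ = comp (directSum (comp π) (comp σ)) := by
  ext i
  refine Fin.addCases (fun i => ?_) (fun i => ?_) i
  · simp [skewSum]; omega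
  · simp [skewSum]; omega

theorem comp_skewSum : comp (skewSum π σ) = directSum (comp π) (comp σ) := by
  rw [skewSum_eq_comp, comp_comp]

theorem comp_directSum : comp (directSum π σ) = skewSum (comp π) (comp σ) := by
  rw [skewSum_eq_comp, comp_comp, comp_comp]

/-- Working on `ℕ` lets sums with different splittings of the same length be compared without casts
between `Fin` types; past the end both sides equal `i`. -/
theorem natFun_directSum (i : ℕ) :
    natFun (directSum π σ) i = if i < m then natFun π i else m + natFun σ (i - m) := by
  by_cases h : i < m
  · rw [if_pos h]
    have := directSum_castAdd π σ ⟨i, h⟩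
    rw [← Fin.val_inj, ← natFun_val] at this
    simpa [natFun, h] using this
  · rw [if_neg h]
    by_cases h' : i < m + n
    · have := directSum_natAdd π σ ⟨i - m, by omega⟩
      rw [← Fin.val_inj, ← natFun_val] at this
      have e : m + (i - m) = i := by omega
      have hn : i - m < n := by omega
      simpa [e, ← natFun_val] using this
    · rw [natFun_of_le _ (by omega), natFun_of_le _ (by omega)]; omega

theorem isCut_directSum (hm : 0 < m) (hn : 0 < n) : IsCut (directSum π σ) m := by
  refine ⟨hm, by omega, fun a b ha hb => ?_⟩
  rw [Fin.lt_def, ← natFun_val, ← natFun_val, natFun_directSum, natFun_directSum,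
    if_pos ha, if_neg (by omega)]
  have := natFun_lt π ha
  omega

theorem directSum_injective {π' : Equiv.Perm (Fin m)} {σ' : Equiv.Perm (Fin n)}
    (h : directSum π σ = directSum π' σ') : π = π' ∧ σ = σ' := by
  constructor
  · refine natFun_injective fun i hi => ?_
    have := congrArg (fun τ => natFun τ i) h
    simpa [natFun_directSum, hi] using this
  · refine natFun_injective fun i hi => ?_
    have := congrArg (fun τ => natFun τ (m + i)) h
    simpa [natFun_directSum] using this

end Sums

theorem isCut_iff_natFun {n : ℕ} (π : Equiv.Perm (Fin n)) (k : ℕ) :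
    IsCut π k ↔ 0 < k ∧ k < n ∧
      ∀ a b, a < k → k ≤ b → b < n → natFun π a < natFun π b := by
  refine and_congr_right fun _ => and_congr_right fun hk => ⟨fun h a b ha hb hn => ?_,
    fun h a b ha hb => ?_⟩
  · simpa [natFun, hn, ha.trans hk] using h ⟨a, ha.trans hk⟩ ⟨b, hn⟩ ha hb
  · simpa [natFun_val] using h a b ha hb b.2

/-- Pigeonhole: the `n` values to the right of the cut all lie above `π a`, which leaves `π a` among
the `m` smallest. -/
theorem IsCut.lt {m n : ℕ} {π : Equiv.Perm (Fin (m + n))} (h : IsCut π m) {a : Fin (m + n)}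
    (ha : (a : ℕ) < m) : (π a : ℕ) < m := by
  have hinj : Function.Injective fun b : Fin n => π (Fin.natAdd m b) :=
    π.injective.comp (Fin.natAdd_injective n m)
  have hsub : (Finset.univ.image fun b : Fin n => π (Fin.natAdd m b)) ⊆ Finset.Ioi (π a) := by
    intro x hx
    obtain ⟨b, -, rfl⟩ := Finset.mem_image.1 hx
    exact Finset.mem_Ioi.2 (h.2.2 a _ ha (by simp))
  have hc := Finset.card_le_card hsub
  rw [Finset.card_image_of_injective _ hinj, Finset.card_univ, Fintype.card_fin, Fin.card_Ioi] at hc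
  have := h.2.1
  omega

theorem IsCut.exists_directSum {m n : ℕ} {π : Equiv.Perm (Fin (m + n))} (h : IsCut π m) :
    ∃ (α : Equiv.Perm (Fin m)) (β : Equiv.Perm (Fin n)), π = directSum α β := by
  have hm : Set.MapsTo (finSumFinEquiv.symm.permCongr π) (Set.range Sum.inl)
      (Set.range Sum.inl) := by
    rintro _ ⟨i, rfl⟩
    have hlt := h.lt (a := Fin.castAdd n i) (by simp)
    refine ⟨⟨_, hlt⟩, ?_⟩
    rw [Equiv.permCongr_apply, Equiv.symm_symm, finSumFinEquiv_apply_left, Equiv.eq_symm_apply,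
      finSumFinEquiv_apply_left]
    rfl
  obtain ⟨⟨α, β⟩, hαβ⟩ := Equiv.Perm.mem_sumCongrHom_range_of_perm_mapsTo_inl hm
  refine ⟨α, β, ?_⟩
  have h2 : Equiv.sumCongr α β = finSumFinEquiv.symm.permCongr π := hαβ
  ext i
  simp [directSum, h2]

theorem Separable.pos {n : ℕ} {π : Equiv.Perm (Fin n)} (h : Separable n π) : 0 < n := by
  induction h <;> omega

theorem Separable.comp {n : ℕ} {π : Equiv.Perm (Fin n)} (h : Separable n π) :
    Separable n (comp π) := by
  induction h with
  | one => rw [Subsingleton.elim (SepPerm.comp _) 1]; exact .one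
  | directSum _ _ h₁ h₂ => rw [comp_directSum]; exact h₁.skewSum h₂
  | skewSum _ _ h₁ h₂ => rw [comp_skewSum]; exact h₁.directSum h₂

theorem separable_comp_iff {n : ℕ} {π : Equiv.Perm (Fin n)} :
    Separable n (comp π) ↔ Separable n π :=
  ⟨fun h => by simpa using h.comp, Separable.comp⟩

/-- A cut, wherever it is, forces the first entry below the last one, and complementation reverses
that inequality. -/
theorem IsCut.not_isCut_comp {n : ℕ} {π : Equiv.Perm (Fin n)} {k : ℕ} (h : IsCut π k) (l : ℕ) :
    ¬ IsCut (SepPerm.comp π) l := by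
  rintro ⟨hl, hln, h'⟩
  obtain ⟨hk, hkn, h⟩ := h
  have h₁ := h ⟨0, by omega⟩ ⟨n - 1, by omega⟩ hk (by simp; omega)
  have h₂ := h' ⟨0, by omega⟩ ⟨n - 1, by omega⟩ hl (by simp; omega)
  simp only [comp_apply, Fin.rev_lt_rev] at h₂
  exact lt_asymm h₁ h₂

/-- Induction on how `π` was built. A skew sum has no cut. If the last step is a direct sum split at
`a`, then for `m < a` the left summand is itself cut at `m`, for `m > a` the right one is cut at `m
- a`, and the middle block is reattached. The free length `N` and the equality of `natFun` keep the
induction index general. -/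
theorem Separable.of_directSum {N : ℕ} {π : Equiv.Perm (Fin N)} (h : Separable N π) :
    ∀ {m n : ℕ} (α : Equiv.Perm (Fin m)) (β : Equiv.Perm (Fin n)), 0 < m → 0 < n → N = m + n →
      (∀ i, natFun π i = natFun (SepPerm.directSum α β) i) → Separable m α ∧ Separable n β := by
  induction h with
  | one => intros; omega
  | @skewSum a b π₁ π₂ h₁ h₂ _ _ =>
    intro m n α β hm hn hN heq
    have hc : IsCut (SepPerm.skewSum π₁ π₂) m := by
      rw [isCut_iff_natFun]
      simp only [heq]
      have := isCut_directSum α β hm hn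
      rw [isCut_iff_natFun] at this
      rwa [hN]
    refine (hc.not_isCut_comp a ?_).elim
    rw [comp_skewSum]
    exact isCut_directSum _ _ h₁.pos h₂.pos
  | @directSum a b π₁ π₂ h₁ h₂ ih₁ ih₂ =>
    intro m n α β hm hn hN heq
    simp only [natFun_directSum] at heq
    rcases lt_trichotomy m a with hlt | rfl | hlt
    · obtain ⟨c, rfl⟩ := Nat.exists_eq_add_of_le hlt.le
      obtain rfl : n = c + b := by omega
      have hcut : IsCut π₁ m := by
        rw [isCut_iff_natFun]
        refine ⟨hm, hlt, fun x y hx hy hyn => ?_⟩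
        have h₁ := heq x
        have h₂ := heq y
        rw [if_pos (by omega), if_pos hx] at h₁
        rw [if_pos hyn, if_neg (by omega)] at h₂
        have := natFun_lt α hx
        omega
      obtain ⟨α', γ, rfl⟩ := hcut.exists_directSum
      obtain ⟨hα, hγ⟩ := ih₁ α' γ hm (by omega) rfl fun _ => rfl
      have e₁ : α = α' := natFun_injective fun i hi => by
        have := heq i
        simpa [natFun_directSum, hi, show i < m + c by omega] using this.symm
      have e₂ : β = SepPerm.directSum γ π₂ := natFun_injective fun i hi => by
        have := heq (m + i)
        rw [natFun_directSum, if_neg (show ¬ m + i < m by omega)] at this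
        rw [natFun_directSum]
        simp only [show m + i < m + c ↔ i < c by omega, Nat.add_sub_cancel_left,
          show ¬ m + i < m by omega, if_false, show m + i - (m + c) = i - c by omega] at this
        split_ifs at this ⊢ <;> omega
      exact ⟨e₁ ▸ hα, e₂ ▸ hγ.directSum h₂⟩
    · obtain rfl : b = n := by omega
      have e := directSum_injective π₁ π₂ (π' := α) (σ' := β)
        (natFun_injective fun i _ => by simpa [natFun_directSum] using heq i)
      exact ⟨e.1 ▸ h₁, e.2 ▸ h₂⟩
    · obtain ⟨c, rfl⟩ := Nat.exists_eq_add_of_le hlt.le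
      have hc : 0 < c := by omega
      obtain rfl : b = c + n := by omega
      have hcut : IsCut π₂ c := by
        rw [isCut_iff_natFun]
        refine ⟨hc, by omega, fun x y hx hy hyn => ?_⟩
        have h₁ := heq (a + x)
        have h₂ := heq (a + y)
        rw [if_neg (by omega), if_pos (by omega)] at h₁
        rw [if_neg (by omega), if_neg (by omega)] at h₂
        rw [Nat.add_sub_cancel_left] at h₁ h₂
        have := natFun_lt α (show a + x < a + c by omega)
        omega
      obtain ⟨γ, β', rfl⟩ := hcut.exists_directSum
      obtain ⟨hγ, hβ⟩ := ih₂ γ β' hc hn rfl fun _ => rfl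
      have e₂ : β = β' := natFun_injective fun i hi => by
        have := heq (a + c + i)
        rw [natFun_directSum, if_neg (by omega), if_neg (by omega), if_neg (by omega),
          Nat.add_sub_cancel_left, show a + c + i - a - c = i by omega] at this
        omega
      have e₁ : α = SepPerm.directSum π₁ γ := natFun_injective fun i hi => by
        have := heq i
        rw [natFun_directSum, if_pos hi] at this
        rw [natFun_directSum]
        split_ifs at this ⊢ <;> omega
      exact ⟨e₁ ▸ h₁.directSum hγ, e₂ ▸ hβ⟩

theorem separable_directSum_iff {m n : ℕ} {π : Equiv.Perm (Fin m)} {σ : Equiv.Perm (Fin n)}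
    (hm : 0 < m) (hn : 0 < n) :
    Separable (m + n) (directSum π σ) ↔ Separable m π ∧ Separable n σ :=
  ⟨fun h => h.of_directSum π σ hm hn rfl fun _ => rfl, fun h => h.1.directSum h.2⟩

/-! ### The four statistics under complement, inverse and sums. -/

section Stats

variable {m n : ℕ} (π : Equiv.Perm (Fin m)) (σ : Equiv.Perm (Fin n))

theorem lmax_comp : lmax m (comp π) = lmin m π := by simp [lmax, lmin]
theorem lmin_comp : lmin m (comp π) = lmax m π := by simp [lmax, lmin]
theorem rmax_comp : rmax m (comp π) = rmin m π := by simp [rmax, rmin]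
theorem rmin_comp : rmin m (comp π) = rmax m π := by simp [rmax, rmin]

/-- "Every smaller value sits earlier" is the contrapositive of "every later position holds a larger
value". Choosing `<` or `>` for `r` on values and `s` on positions covers all the inverse symmetries
needed. -/
theorem card_filter_inv {r s : Fin m → Fin m → Prop} [DecidableRel r] [DecidableRel s]
    (hr : ∀ a b, a ≠ b → (r a b ↔ ¬ r b a)) (hs : ∀ a b, a ≠ b → (s a b ↔ ¬ s b a))
    (hr' : ∀ a, ¬ r a a) (hs' : ∀ a, ¬ s a a) :
    (Finset.univ.filter fun i => ∀ j, r j i → s (π⁻¹ j) (π⁻¹ i)).card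
      = (Finset.univ.filter fun i => ∀ j, s i j → r (π i) (π j)).card := by
  refine Finset.card_equiv π⁻¹ fun i => ?_
  simp only [Finset.mem_filter, Finset.mem_univ, true_and]
  obtain ⟨i, rfl⟩ := π.surjective i
  have h : ∀ x, π⁻¹ (π x) = x := π.symm_apply_apply
  refine (π.forall_congr_right (q := fun j => r j (π i) → s (π⁻¹ j) (π⁻¹ (π i)))).symm.trans
    (forall_congr' fun j => ?_)
  rw [h, h]
  rcases eq_or_ne i j with rfl | hij
  · simp [hr', hs']
  · rw [hs i j hij, hr (π i) (π j) (π.injective.ne hij)]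
    tauto

theorem lmax_inv : lmax m π⁻¹ = rmin m π := by
  exact card_filter_inv π (r := (· < ·)) (s := (· < ·)) (fun a b h => by omega)
    (fun a b h => by omega) (fun a => by omega) (fun a => by omega)

theorem rmin_inv : rmin m π⁻¹ = lmax m π := by rw [← lmax_inv, inv_inv]

theorem rmax_inv : rmax m π⁻¹ = rmax m π := by
  exact card_filter_inv π (r := (· > ·)) (s := (· < ·)) (fun a b h => by omega)
    (fun a b h => by omega) (fun a => by omega) (fun a => by omega)

theorem lmin_inv : lmin m π⁻¹ = lmin m π := by
  exact card_filter_inv π (r := (· < ·)) (s := (· > ·)) (fun a b h => by omega)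
    (fun a b h => by omega) (fun a => by omega) (fun a => by omega)

theorem castAdd_lt_natAdd (i : Fin m) (j : Fin n) : Fin.castAdd n i < Fin.natAdd m j := by
  simp [Fin.lt_def]; omega

theorem not_natAdd_lt_castAdd (i : Fin m) (j : Fin n) : ¬ Fin.natAdd m j < Fin.castAdd n i :=
  (castAdd_lt_natAdd i j).asymm

theorem castAdd_lt_castAdd (i j : Fin m) : Fin.castAdd n i < Fin.castAdd n j ↔ i < j := Iff.rfl

theorem natAdd_lt_natAdd (i j : Fin n) : Fin.natAdd m i < Fin.natAdd m j ↔ i < j := by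
  simp

theorem lmax_directSum : lmax (m + n) (directSum π σ) = lmax m π + lmax n σ := by
  simp only [lmax, Finset.card_filter, Fin.sum_univ_add, Fin.forall_fin_add, directSum_castAdd,
    directSum_natAdd, castAdd_lt_natAdd, not_natAdd_lt_castAdd, castAdd_lt_castAdd,
    natAdd_lt_natAdd]
  simp

theorem rmin_directSum : rmin (m + n) (directSum π σ) = rmin m π + rmin n σ := by
  simp only [rmin, Finset.card_filter, Fin.sum_univ_add, Fin.forall_fin_add, directSum_castAdd,
    directSum_natAdd, castAdd_lt_natAdd, not_natAdd_lt_castAdd, castAdd_lt_castAdd,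
    natAdd_lt_natAdd]
  simp

/-- Any entry of the right block dominates the whole left block, so nonemptiness of the right block
is what removes the left contribution. -/
theorem rmax_directSum (hn : 0 < n) : rmax (m + n) (directSum π σ) = rmax n σ := by
  have : Nonempty (Fin n) := ⟨⟨0, hn⟩⟩
  simp only [rmax, Finset.card_filter, Fin.sum_univ_add, Fin.forall_fin_add, directSum_castAdd,
    directSum_natAdd, castAdd_lt_natAdd, not_natAdd_lt_castAdd, castAdd_lt_castAdd,
    natAdd_lt_natAdd]
  simp

theorem lmin_directSum (hm : 0 < m) : lmin (m + n) (directSum π σ) = lmin m π := by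
  have : Nonempty (Fin m) := ⟨⟨0, hm⟩⟩
  simp only [lmin, Finset.card_filter, Fin.sum_univ_add, Fin.forall_fin_add, directSum_castAdd,
    directSum_natAdd, castAdd_lt_natAdd, not_natAdd_lt_castAdd, castAdd_lt_castAdd,
    natAdd_lt_natAdd]
  simp

theorem lmax_skewSum (hm : 0 < m) : lmax (m + n) (skewSum π σ) = lmax m π := by
  rw [skewSum_eq_comp, lmax_comp, lmin_directSum _ _ hm, lmin_comp]

theorem rmax_skewSum : rmax (m + n) (skewSum π σ) = rmax m π + rmax n σ := by
  rw [skewSum_eq_comp, rmax_comp, rmin_directSum, rmin_comp, rmin_comp]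

theorem lmin_skewSum : lmin (m + n) (skewSum π σ) = lmin m π + lmin n σ := by
  rw [skewSum_eq_comp, lmin_comp, lmax_directSum, lmax_comp, lmax_comp]

end Stats

/-! ### Inversion, irreducibility and the first cut. -/

theorem directSum_inv {m n : ℕ} (π : Equiv.Perm (Fin m)) (σ : Equiv.Perm (Fin n)) :
    (directSum π σ)⁻¹ = directSum π⁻¹ σ⁻¹ := by
  rw [inv_eq_iff_mul_eq_one]
  ext i
  refine Fin.addCases (fun i => ?_) (fun i => ?_) i <;> simp

theorem Separable.of_natFun {m n : ℕ} {π : Equiv.Perm (Fin m)} {σ : Equiv.Perm (Fin n)}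
    (hπ : Separable m π) (h : m = n) (hσ : ∀ i, i < n → natFun σ i = natFun π i) :
    Separable n σ := by
  subst h
  rwa [natFun_injective hσ]

theorem natFun_eq_of_inv {n : ℕ} {π : Equiv.Perm (Fin n)} {i j : ℕ} (hj : j < n)
    (h : natFun π j = i) : natFun π⁻¹ i = j := by
  have hi : i < n := h ▸ natFun_lt π hj
  have : π⁻¹ ⟨i, hi⟩ = ⟨j, hj⟩ := by
    rw [Equiv.Perm.inv_eq_iff_eq, ← Fin.val_inj, ← natFun_val]
    exact h.symm
  rw [natFun, dif_pos hi, this]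

theorem natFun_skewSum {m n : ℕ} (π : Equiv.Perm (Fin m)) (σ : Equiv.Perm (Fin n)) {i : ℕ}
    (hi : i < m + n) :
    natFun (skewSum π σ) i = if i < m then n + natFun π i else natFun σ (i - m) := by
  have key : ∀ i : Fin (m + n), natFun (skewSum π σ) i =
      if (i : ℕ) < m then n + natFun π i else natFun σ (i - m) := by
    intro i
    rw [natFun_val]
    refine Fin.addCases (fun i => ?_) (fun i => ?_) i
    · simp [skewSum, natFun_val, Nat.add_comm]
    · simp [skewSum, natFun_val]
  exact key ⟨i, hi⟩

theorem Separable.inv {n : ℕ} {π : Equiv.Perm (Fin n)} (h : Separable n π) :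
    Separable n π⁻¹ := by
  induction h with
  | one => exact .one
  | directSum _ _ h₁ h₂ => rw [directSum_inv]; exact h₁.directSum h₂
  | @skewSum a b π σ _ _ h₁ h₂ =>
    -- The inverse of `π ⊖ σ` is `σ⁻¹ ⊖ π⁻¹`, whose length reads `b + a` instead of `a + b`.
    refine (h₂.skewSum h₁).of_natFun (Nat.add_comm _ _) fun i hi => ?_
    have hlt := natFun_lt (SepPerm.skewSum σ⁻¹ π⁻¹) (show i < b + a by omega)
    refine natFun_eq_of_inv (by omega) ?_
    rw [natFun_skewSum _ _ (by omega), natFun_skewSum _ _ (by omega)]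
    have inv_inv' : ∀ {k : ℕ} (τ : Equiv.Perm (Fin k)) {x : ℕ}, x < k →
        natFun τ (natFun τ⁻¹ x) = x := fun τ x hx => by
      have := natFun_eq_of_inv (π := τ⁻¹) hx rfl
      rwa [inv_inv] at this
    by_cases hb : i < b
    · rw [if_pos hb, if_neg (by omega), Nat.add_sub_cancel_left, inv_inv' σ hb]
    · have := natFun_lt π⁻¹ (show i - b < a by omega)
      rw [if_neg hb, if_pos this, inv_inv' π (by omega)]
      omega

theorem separable_inv_iff {n : ℕ} {π : Equiv.Perm (Fin n)} :
    Separable n π⁻¹ ↔ Separable n π :=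
  ⟨fun h => by simpa using h.inv, Separable.inv⟩

theorem IsCut.inv {n k : ℕ} {π : Equiv.Perm (Fin n)} (h : IsCut π k) : IsCut π⁻¹ k := by
  obtain ⟨l, rfl⟩ := Nat.exists_eq_add_of_le h.2.1.le
  obtain ⟨α, β, rfl⟩ := h.exists_directSum
  rw [directSum_inv]
  exact isCut_directSum _ _ h.1 (by have := h.2.1; omega)

theorem reducible_iff {n : ℕ} {π : Equiv.Perm (Fin n)} :
    Reducible n π ↔ ∃ k, IsCut π k := by
  constructor
  · rintro ⟨hn, h⟩
    by_contra hc
    exact h ⟨hn, hc⟩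
  · rintro ⟨k, h⟩
    exact ⟨by have := h.2.1; omega, fun h' => h'.2 ⟨k, h⟩⟩

theorem irreducible_iff {n : ℕ} {π : Equiv.Perm (Fin n)} :
    Irreducible n π ↔ 0 < n ∧ ¬ ∃ k, IsCut π k := Iff.rfl

theorem reducible_inv_iff {n : ℕ} {π : Equiv.Perm (Fin n)} :
    Reducible n π⁻¹ ↔ Reducible n π := by
  simp only [reducible_iff]
  exact exists_congr fun k => ⟨fun h => by simpa using h.inv, IsCut.inv⟩

theorem irreducible_inv_iff {n : ℕ} {π : Equiv.Perm (Fin n)} :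
    Irreducible n π⁻¹ ↔ Irreducible n π := by
  simp only [irreducible_iff]
  exact and_congr_right fun _ => not_congr <|
    exists_congr fun k => ⟨fun h => by simpa using h.inv, IsCut.inv⟩

theorem Separable.trichotomy {n : ℕ} {π : Equiv.Perm (Fin n)} (h : Separable n π) :
    n = 1 ∨ Reducible n π ∨ Reducible n (SepPerm.comp π) := by
  cases h with
  | one => exact .inl rfl
  | directSum h₁ h₂ => exact .inr (.inl (reducible_iff.2 ⟨_, isCut_directSum _ _ h₁.pos h₂.pos⟩))
  | skewSum h₁ h₂ =>
    rw [comp_skewSum]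
    exact .inr (.inr (reducible_iff.2 ⟨_, isCut_directSum _ _ h₁.pos h₂.pos⟩))

theorem Reducible.one_lt {n : ℕ} {π : Equiv.Perm (Fin n)} (h : Reducible n π) : 1 < n := by
  obtain ⟨k, h₁, h₂, -⟩ := reducible_iff.1 h
  omega

theorem Reducible.not_comp {n : ℕ} {π : Equiv.Perm (Fin n)} (h : Reducible n π) :
    ¬ Reducible n (SepPerm.comp π) := by
  obtain ⟨k, h⟩ := reducible_iff.1 h
  rw [reducible_iff]
  rintro ⟨l, h'⟩
  exact h.not_isCut_comp l h'

theorem Separable.irreducible_iff {n : ℕ} {π : Equiv.Perm (Fin n)} (h : Separable n π) :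
    Irreducible n π ↔ n = 1 ∨ Reducible n (SepPerm.comp π) := by
  have h₁ : Irreducible n π ↔ ¬ Reducible n π := by
    rw [reducible_iff, SepPerm.irreducible_iff]
    exact and_iff_right h.pos
  rw [h₁]
  constructor
  · intro h'
    simpa [h'] using h.trichotomy
  · rintro (rfl | h') h₂
    · exact absurd h₂.one_lt (lt_irrefl _)
    · exact h₂.not_comp h'

theorem isCut_directSum_iff {k l j : ℕ} (π : Equiv.Perm (Fin k)) (σ : Equiv.Perm (Fin l))
    (hj : j < k) : IsCut (directSum π σ) j ↔ IsCut π j := by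
  simp only [isCut_iff_natFun, natFun_directSum]
  refine and_congr_right fun _ => ⟨fun h => ⟨hj, fun a b ha hb hbk => ?_⟩,
    fun h => ⟨by omega, fun a b ha hb hbk => ?_⟩⟩
  · have := h.2 a b ha hb (by omega)
    rwa [if_pos (by omega), if_pos hbk] at this
  · rw [if_pos (by omega)]
    split_ifs with h'
    · exact h.2 a b ha hb h'
    · have := natFun_lt π (show a < k by omega)
      omega

/-- The least position at which a permutation can be cut. -/
noncomputable def firstCut {n : ℕ} (π : Equiv.Perm (Fin n)) : ℕ := sInf {k | IsCut π k}

theorem isCut_firstCut {n : ℕ} {π : Equiv.Perm (Fin n)} (h : Reducible n π) :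
    IsCut π (firstCut π) :=
  Nat.sInf_mem (reducible_iff.1 h)

theorem firstCut_directSum {k l : ℕ} {π : Equiv.Perm (Fin k)} (σ : Equiv.Perm (Fin l))
    (hπ : Irreducible k π) (hl : 0 < l) : firstCut (directSum π σ) = k := by
  refine IsLeast.csInf_eq ⟨isCut_directSum _ _ hπ.1 hl, fun j hj => ?_⟩
  by_contra hc
  exact hπ.2 ⟨j, (isCut_directSum_iff _ _ (not_le.1 hc)).1 hj⟩

theorem irreducible_of_firstCut {k l : ℕ} {π : Equiv.Perm (Fin k)} {σ : Equiv.Perm (Fin l)}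
    (hk : 0 < k) (h : firstCut (directSum π σ) = k) : Irreducible k π := by
  refine ⟨hk, ?_⟩
  rintro ⟨j, hj⟩
  have : firstCut (directSum π σ) ≤ j := Nat.sInf_le ((isCut_directSum_iff π σ hj.2.1).2 hj)
  have := hj.2.1
  omega

/-! ### Generating functions and the unique decomposition. -/

section GenFun

variable {K : Type*} [Field K]

open Classical in
/-- The generating function of the permutations in the class `P` with weights `w`. -/
noncomputable def genFun (P : ∀ n : ℕ, Equiv.Perm (Fin n) → Prop)
    (w : ∀ n : ℕ, Equiv.Perm (Fin n) → K) : K⟦X⟧ :=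
  PowerSeries.mk fun n => ∑ π : Equiv.Perm (Fin n) with P n π, w n π

variable {P Q R : ∀ n : ℕ, Equiv.Perm (Fin n) → Prop}
  {w w₁ w₂ : ∀ n : ℕ, Equiv.Perm (Fin n) → K}

theorem genFun_eq_of_equiv (e : ∀ n, Equiv.Perm (Fin n) ≃ Equiv.Perm (Fin n))
    (hP : ∀ n π, P n π ↔ Q n (e n π)) (hw : ∀ n π, Q n (e n π) → w₁ n π = w₂ n (e n π)) :
    genFun P w₁ = genFun Q w₂ := by
  ext n
  simp only [genFun, PowerSeries.coeff_mk]
  refine Finset.sum_equiv (e n) (by simp [hP]) fun π hπ => hw n π ?_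
  simpa [hP] using hπ

theorem genFun_congr (hP : ∀ n π, P n π ↔ Q n π) (hw : ∀ n π, Q n π → w₁ n π = w₂ n π) :
    genFun P w₁ = genFun Q w₂ :=
  genFun_eq_of_equiv (fun _ => Equiv.refl _) hP hw

theorem genFun_add (hP : ∀ n π, R n π ↔ P n π ∨ Q n π) (hd : ∀ n π, P n π → ¬ Q n π) :
    genFun R w = genFun P w + genFun Q w := by
  classical
  ext n
  simp only [genFun, PowerSeries.coeff_mk, map_add]
  rw [← Finset.sum_union (Finset.disjoint_filter.2 fun π _ => hd n π), ← Finset.filter_or]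
  refine Finset.sum_congr ?_ fun _ _ => rfl
  ext π
  simp [hP]

theorem genFun_length_one :
    genFun (fun n _ => n = 1) w = PowerSeries.C (w 1 1) * PowerSeries.X := by
  ext n
  simp only [genFun, PowerSeries.coeff_mk, PowerSeries.coeff_C_mul, PowerSeries.coeff_X]
  by_cases h : n = 1
  · subst h
    simp
  · simp [h]

/-- Fibring over the first cut turns the sum into a Cauchy product: the part before the first cut is
irreducible, and the part after it is an arbitrary separable permutation. -/
theorem genFun_redSeparable
    (hw : ∀ m n (π : Equiv.Perm (Fin m)) (σ : Equiv.Perm (Fin n)), 0 < m → 0 < n →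
      w (m + n) (directSum π σ) = w₁ m π * w₂ n σ) :
    genFun RedSeparable w = genFun IrrSeparable w₁ * genFun Separable w₂ := by
  classical
  ext N
  simp only [genFun, PowerSeries.coeff_mk, PowerSeries.coeff_mul]
  rw [← Finset.sum_fiberwise_of_maps_to (t := Finset.HasAntidiagonal.antidiagonal N)
    (g := fun π => (firstCut π, N - firstCut π))]
  · refine Finset.sum_congr rfl fun ⟨k, l⟩ hp => ?_
    obtain rfl : k + l = N := by simpa using hp
    rw [Finset.sum_mul_sum, ← Finset.sum_product']
    symm
    refine Finset.sum_bij (fun p _ => directSum p.1 p.2) ?_ ?_ ?_ ?_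
    · rintro ⟨α, β⟩ h
      simp only [Finset.mem_product, Finset.mem_filter, Finset.mem_univ, true_and] at h
      have hc := firstCut_directSum β h.1.2 h.2.pos
      simp only [Finset.mem_filter, Finset.mem_univ, true_and, hc, Nat.add_sub_cancel_left,
        and_true]
      exact ⟨h.1.1.directSum h.2, reducible_iff.2 ⟨k, isCut_directSum _ _ h.1.2.1 h.2.pos⟩⟩
    · rintro ⟨α, β⟩ - ⟨α', β'⟩ - h
      obtain ⟨rfl, rfl⟩ := directSum_injective _ _ h
      rfl
    · intro π h
      simp only [Finset.mem_filter, Finset.mem_univ, true_and, Prod.mk.injEq] at h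
      obtain ⟨⟨hs, hr⟩, hk, -⟩ := h
      have hc := isCut_firstCut hr
      rw [hk] at hc
      obtain ⟨α, β, rfl⟩ := hc.exists_directSum
      have hl : 0 < l := by have := hc.2.1; omega
      obtain ⟨hα, hβ⟩ := (separable_directSum_iff hc.1 hl).1 hs
      exact ⟨(α, β), by simpa using ⟨⟨hα, irreducible_of_firstCut hc.1 hk⟩, hβ⟩, rfl⟩
    · rintro ⟨α, β⟩ h
      simp only [Finset.mem_product, Finset.mem_filter, Finset.mem_univ, true_and] at h
      exact (hw _ _ _ _ h.1.1.pos h.2.pos).symm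
  · intro π hπ
    have := (isCut_firstCut (by simpa using (Finset.mem_filter.1 hπ).2.2)).2.1
    simp
    omega

/-- Separable permutations which are skew sums. -/
def SkewRed (n : ℕ) (π : Equiv.Perm (Fin n)) : Prop := RedSeparable n (comp π)

/-- Separable permutations which are not skew sums. -/
def SkewIrr (n : ℕ) (π : Equiv.Perm (Fin n)) : Prop := IrrSeparable n (comp π)

/-- Complementation as an equivalence. -/
def compEquiv (n : ℕ) : Equiv.Perm (Fin n) ≃ Equiv.Perm (Fin n) where
  toFun := comp
  invFun := comp
  left_inv := comp_comp
  right_inv := comp_comp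

theorem genFun_comp (P : ∀ n : ℕ, Equiv.Perm (Fin n) → Prop)
    (w : ∀ n : ℕ, Equiv.Perm (Fin n) → K) :
    genFun (fun n π => P n (comp π)) (fun n π => w n (comp π)) = genFun P w :=
  genFun_eq_of_equiv compEquiv (fun _ _ => Iff.rfl) fun _ _ _ => rfl

theorem genFun_skewRed
    (hw : ∀ m n (π : Equiv.Perm (Fin m)) (σ : Equiv.Perm (Fin n)), 0 < m → 0 < n →
      w (m + n) (skewSum π σ) = w₁ m π * w₂ n σ) :
    genFun SkewRed w = genFun SkewIrr w₁ * genFun Separable w₂ := by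
  have h := genFun_redSeparable (w := fun n π => w n (comp π)) (w₁ := fun n π => w₁ n (comp π))
    (w₂ := fun n π => w₂ n (comp π)) fun m n π σ hm hn => by
      rw [comp_directSum, hw _ _ _ _ hm hn]
  rw [← genFun_comp RedSeparable, ← genFun_comp IrrSeparable, ← genFun_comp Separable] at h
  simp only [comp_comp, separable_comp_iff] at h
  exact h

theorem genFun_separable :
    genFun Separable w = genFun RedSeparable w + genFun IrrSeparable w := by
  refine genFun_add (fun n π => ⟨fun h => ?_, fun h => h.elim And.left And.left⟩)
    fun n π h h' => h.2.2 h'.2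
  by_cases hi : Irreducible n π
  · exact .inr ⟨h, hi⟩
  · exact .inl ⟨h, h.pos, hi⟩

theorem separable_one_of_eq {n : ℕ} (h : n = 1) (π : Equiv.Perm (Fin n)) : Separable n π := by
  subst h
  rw [Subsingleton.elim π 1]
  exact .one

/-- By the dichotomy between ⊕ and ⊖, an irreducible separable permutation has length one or is a
skew sum. -/
theorem genFun_irrSeparable :
    genFun IrrSeparable w = PowerSeries.C (w 1 1) * PowerSeries.X + genFun SkewRed w := by
  rw [← genFun_length_one]
  refine genFun_add (fun n π => ⟨fun h => ?_, fun h => ?_⟩) fun n π h h' => ?_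
  · exact (h.1.irreducible_iff.1 h.2).imp_right fun h' => ⟨h.1.comp, h'⟩
  · have hs : Separable n π :=
      h.elim (fun h => separable_one_of_eq h π) fun h => separable_comp_iff.1 h.1
    exact ⟨hs, hs.irreducible_iff.2 (h.imp_right And.right)⟩
  · exact absurd h'.2.one_lt (by omega)

theorem genFun_skewIrr :
    genFun SkewIrr w = PowerSeries.C (w 1 1) * PowerSeries.X + genFun RedSeparable w := by
  have h := genFun_irrSeparable (w := fun n π => w n (comp π))
  rw [← genFun_comp IrrSeparable, ← genFun_comp SkewRed] at h
  simp only [comp_comp, SkewRed] at h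
  rwa [Subsingleton.elim (comp 1) (1 : Equiv.Perm (Fin 1))] at h

theorem gf₃_eq_genFun (P : ∀ n : ℕ, Equiv.Perm (Fin n) → Prop) (s₁ s₂ s₃ : Stat) (z₁ z₂ z₃ : K) :
    gf₃ P s₁ s₂ s₃ z₁ z₂ z₃
      = genFun P fun n π => z₁ ^ s₁ n π * z₂ ^ s₂ n π * z₃ ^ s₃ n π := rfl

/-! ### The equations for the generating functions of `(lmax, rmax, lmin)` -/

/-- The monomial weight of a permutation by `(lmax, rmax, lmin)`. -/
def weight (z₁ z₂ z₃ : K) (n : ℕ) (π : Equiv.Perm (Fin n)) : K :=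
  z₁ ^ lmax n π * z₂ ^ rmax n π * z₃ ^ lmin n π

variable (z₁ z₂ z₃ : K)

theorem weight_one : weight z₁ z₂ z₃ 1 1 = z₁ * z₂ * z₃ := by
  simp [weight, lmax, rmax, lmin]

/-- A variable is set to 1 in the factor that its statistic ignores: rmax does not see the left
summand, lmin does not see the right one. -/
theorem genFun_redSeparable_weight :
    genFun RedSeparable (weight z₁ z₂ z₃)
      = genFun IrrSeparable (weight z₁ 1 z₃) * genFun Separable (weight z₁ z₂ 1) :=
  genFun_redSeparable fun m n π σ hm hn => by
    simp only [weight, lmax_directSum, rmax_directSum _ _ hn, lmin_directSum _ _ hm, one_pow]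
    ring

theorem genFun_skewRed_weight :
    genFun SkewRed (weight z₁ z₂ z₃)
      = genFun SkewIrr (weight z₁ z₂ z₃) * genFun Separable (weight 1 z₂ z₃) :=
  genFun_skewRed fun m n π σ hm hn => by
    simp only [weight, lmax_skewSum _ _ hm, rmax_skewSum, lmin_skewSum, one_pow]
    ring

theorem constantCoeff_genFun (hP : ∀ π, ¬ P 0 π) :
    PowerSeries.constantCoeff (genFun P w) = 0 := by
  rw [← PowerSeries.coeff_zero_eq_constantCoeff_apply]
  simp [genFun, hP]

theorem constantCoeff_genFun_separable :
    PowerSeries.constantCoeff (genFun Separable w) = 0 :=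
  constantCoeff_genFun fun _ h => lt_irrefl _ h.pos

/-- Inversion exchanges `lmax` and `rmin` and fixes `rmax` and `lmin`. -/
theorem gf₃_rmin_rmax_lmin (hP : ∀ n (π : Equiv.Perm (Fin n)), P n π⁻¹ ↔ P n π) :
    gf₃ P rmin rmax lmin z₁ z₂ z₃ = genFun P (weight z₁ z₂ z₃) :=
  genFun_eq_of_equiv (fun _ => Equiv.inv _) (fun n π => (hP n π).symm) fun n π _ => by
    simp [weight, lmax_inv, rmax_inv, lmin_inv]

theorem gf₃_comp (P : ∀ n : ℕ, Equiv.Perm (Fin n) → Prop) (s₁ s₂ s₃ s₁' s₂' s₃' : Stat)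
    (h₁ : ∀ n π, s₁ n (comp π) = s₁' n π) (h₂ : ∀ n π, s₂ n (comp π) = s₂' n π)
    (h₃ : ∀ n π, s₃ n (comp π) = s₃' n π) :
    gf₃ P s₁ s₂ s₃ z₁ z₂ z₃ = gf₃ (fun n π => P n (comp π)) s₁' s₂' s₃' z₁ z₂ z₃ := by
  rw [gf₃_eq_genFun, ← genFun_comp]
  simp only [h₁, h₂, h₃]
  rfl

theorem irrSeparable_inv_iff (n : ℕ) (π : Equiv.Perm (Fin n)) :
    IrrSeparable n π⁻¹ ↔ IrrSeparable n π :=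
  and_congr separable_inv_iff irreducible_inv_iff

theorem redSeparable_inv_iff (n : ℕ) (π : Equiv.Perm (Fin n)) :
    RedSeparable n π⁻¹ ↔ RedSeparable n π :=
  and_congr separable_inv_iff reducible_inv_iff

end GenFun

/-! ### Solving the equations: the one-variable series and the square roots. -/

section Algebra

variable {K : Type*} [Field K]

theorem sqrt_eq_of_sq_eq [CharZero K] {f g : K⟦X⟧} (h : g ^ 2 = f)
    (hg : PowerSeries.constantCoeff g = 1) : sqrt f = g := by
  have hf : PowerSeries.constantCoeff f = 1 := by rw [← h, map_pow, hg, one_pow]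
  rcases sq_eq_sq_iff_eq_or_eq_neg.1 ((sqrt_sq f hf).trans h.symm) with h' | h'
  · exact h'
  · have := congrArg PowerSeries.constantCoeff h'
    rw [constantCoeff_sqrt, map_neg, hg] at this
    norm_num at this

theorem coe_ne_zero {g : K⟦X⟧} (hg : PowerSeries.constantCoeff g = 1) :
    (g : K⸨X⸩) ≠ 0 := by
  rw [← map_zero (HahnSeries.ofPowerSeries ℤ K), HahnSeries.ofPowerSeries_injective.ne_iff]
  rintro rfl
  simp at hg

/-- The generating function of irreducible separable permutations by length. -/
noncomputable def irrGenFun (K : Type*) [Field K] : K⟦X⟧ := genFun IrrSeparable (weight (1 : K) 1 1)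

theorem genFun_separable_eq : genFun Separable (weight (1 : K) 1 1)
    = 2 * irrGenFun K - PowerSeries.X ∧ genFun SkewIrr (weight (1 : K) 1 1) = irrGenFun K := by
  have hR := genFun_redSeparable_weight (1 : K) 1 1
  have hQ := genFun_skewRed_weight (1 : K) 1 1
  have hF := genFun_separable (w := weight (1 : K) 1 1)
  have hI := genFun_irrSeparable (w := weight (1 : K) 1 1)
  have hJ := genFun_skewIrr (w := weight (1 : K) 1 1)
  have hc := constantCoeff_genFun_separable (w := weight (1 : K) 1 1)
  rw [weight_one, mul_one, mul_one, map_one, one_mul] at hI hJ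
  rw [← irrGenFun] at *
  have h0 : (1 + genFun Separable (weight (1 : K) 1 1)) ≠ 0 := by
    intro h
    have := congrArg PowerSeries.constantCoeff h
    simp [hc] at this
  have hIJ : genFun SkewIrr (weight (1 : K) 1 1) = irrGenFun K := by
    -- I - J = Q - R = (J - I)F, hence (I - J)(1 + F) = 0.
    refine mul_right_cancel₀ h0 ?_
    linear_combination hJ - hI + hR - hQ
  exact ⟨by linear_combination hF - hJ + hIJ, hIJ⟩

theorem irrGenFun_quadratic :
    2 * irrGenFun K ^ 2 - (1 + PowerSeries.X) * irrGenFun K + PowerSeries.X = 0 := by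
  obtain ⟨hF, hIJ⟩ := genFun_separable_eq (K := K)
  have hI := genFun_irrSeparable (w := weight (1 : K) 1 1)
  rw [genFun_skewRed_weight, hF, hIJ, weight_one, mul_one, mul_one, map_one, one_mul,
    ← irrGenFun] at hI
  linear_combination -hI

theorem constantCoeff_irrGenFun : PowerSeries.constantCoeff (irrGenFun K) = 0 :=
  constantCoeff_genFun fun _ h => lt_irrefl _ h.1.pos

theorem irrGenFun_ne_zero : irrGenFun K ≠ 0 := by
  intro h
  have := irrGenFun_quadratic (K := K)
  simp [h, PowerSeries.X_ne_zero] at this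

theorem r_eq [CharZero K] : (r : K⟦X⟧) = 1 + PowerSeries.X - 4 * irrGenFun K := by
  refine sqrt_eq_of_sq_eq ?_ (by simp [constantCoeff_irrGenFun])
  linear_combination 8 * irrGenFun_quadratic (K := K)

/-- With only rmax marked, R = I(1,1,1) F, so the system closes up in F alone. -/
theorem genFun_weight_rmax_quadratic (z : K) :
    irrGenFun K * genFun Separable (weight 1 z 1) ^ 2
      + (PowerSeries.C z * PowerSeries.X + irrGenFun K - 1) * genFun Separable (weight 1 z 1)
      + PowerSeries.C z * PowerSeries.X = 0 := by
  have hR := genFun_redSeparable_weight 1 z 1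
  have hQ := genFun_skewRed_weight 1 z 1
  have hF := genFun_separable (w := weight 1 z 1)
  have hI := genFun_irrSeparable (w := weight 1 z 1)
  have hJ := genFun_skewIrr (w := weight 1 z 1)
  rw [← irrGenFun] at hR
  rw [weight_one, mul_one, one_mul] at hI hJ
  linear_combination -hF - hI - hQ - (1 + genFun Separable (weight 1 z 1)) * hR
    - genFun Separable (weight 1 z 1) * hJ

/-- The right side is minus the derivative of the preceding quadratic at its root, so its square is
the discriminant; the constant term 1 fixes the sign. -/
theorem q_eq [CharZero K] (z : K) :
    q z = 1 - PowerSeries.C z * PowerSeries.X - irrGenFun K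
      - 2 * irrGenFun K * genFun Separable (weight 1 z 1) := by
  refine sqrt_eq_of_sq_eq ?_
    (by simp [constantCoeff_irrGenFun])
  have h4 : 4 * (PowerSeries.C (1 / 4) : K⟦X⟧) = 1 := by
    rw [← map_ofNat PowerSeries.C 4, ← map_mul, mul_one_div_cancel (by norm_num), map_one]
  have h5 : (PowerSeries.C (5 / 4) : K⟦X⟧) = 1 + PowerSeries.C (1 / 4) := by
    rw [← map_one PowerSeries.C, ← map_add]
    norm_num
  have hin : -PowerSeries.C (1 / 4) * r - PowerSeries.X * PowerSeries.C z
      + PowerSeries.C (1 / 4) * PowerSeries.X + PowerSeries.C (5 / 4)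
      = 1 + irrGenFun K - PowerSeries.X * PowerSeries.C z := by
    rw [r_eq, h5]
    linear_combination irrGenFun K * h4
  rw [hin, r_eq]
  linear_combination 4 * irrGenFun K * genFun_weight_rmax_quadratic z

theorem S_eq [CharZero K] (z : K) : S z = (genFun Separable (weight 1 z 1) : K⸨X⸩) := by
  have h8 : (8 : K⸨X⸩) ≠ 0 := by
    rw [← map_ofNat (HahnSeries.C : K →+* K⸨X⸩) 8]
    exact HahnSeries.C_ne_zero (by norm_num)
  have hi : (irrGenFun K : K⸨X⸩) ≠ 0 := by
    rw [← map_zero (HahnSeries.ofPowerSeries ℤ K), HahnSeries.ofPowerSeries_injective.ne_iff]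
    exact irrGenFun_ne_zero
  have hden : 2 * (((r : K⟦X⟧) : K⸨X⸩) - t - 1) = -(8 * (irrGenFun K : K⸨X⸩)) := by
    rw [r_eq, t]
    simp only [map_sub, map_add, map_mul, map_one, map_ofNat]
    ring
  rw [S, hden, div_eq_iff (neg_ne_zero.2 (mul_ne_zero h8 hi)), r_eq, q_eq, t, c]
  simp only [map_sub, map_add, map_mul, map_one, map_ofNat]
  ring

theorem gf₁_rmax (z : K) : gf₁ Separable rmax z = genFun Separable (weight 1 z 1) :=
  genFun_congr (fun _ _ => Iff.rfl) fun _ _ _ => by simp [weight]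

theorem gf₁_comp (s s' : Stat) (h : ∀ n π, s n (comp π) = s' n π) (z : K) :
    gf₁ Separable s z = gf₁ Separable s' z :=
  (genFun_eq_of_equiv compEquiv (fun _ _ => separable_comp_iff.symm) fun n π _ => by
    rw [← h]; rfl).symm

/-- Inversion links lmax to rmin; complementation links the maxima to the minima, so all four
statistics are equidistributed. -/
theorem gf₁_lmax_eq_rmin (z : K) : gf₁ Separable lmax z = gf₁ Separable rmin z :=
  genFun_eq_of_equiv (fun _ => Equiv.inv _) (fun _ _ => separable_inv_iff.symm) fun n π _ => by
    simp [rmin_inv]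

theorem gf₁_lmax (z : K) : gf₁ Separable lmax z = genFun Separable (weight 1 z 1) := by
  rw [gf₁_lmax_eq_rmin, gf₁_comp rmin rmax (fun _ => rmin_comp), gf₁_rmax]

theorem gf₁_lmin (z : K) : gf₁ Separable lmin z = genFun Separable (weight 1 z 1) := by
  rw [gf₁_comp lmin lmax (fun _ => lmin_comp), gf₁_lmax]

theorem coe_gf₁ [CharZero K] {s : Stat} (hs : s ∈ ({lmax, rmax, lmin, rmin} : Set Stat)) (z : K) :
    (gf₁ Separable s z : K⸨X⸩) = S z := by
  rw [S_eq]
  rcases hs with rfl | rfl | rfl | rfl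
  · rw [gf₁_lmax]
  · rw [gf₁_rmax]
  · rw [gf₁_lmin]
  · rw [← gf₁_lmax_eq_rmin, gf₁_lmax]

theorem genFun_weight_lmax (z : K) :
    genFun Separable (weight z 1 1) = genFun Separable (weight 1 z 1) := by
  rw [← gf₁_lmax]
  exact genFun_congr (fun _ _ => Iff.rfl) fun _ _ _ => by simp [weight]

theorem genFun_weight_lmin (z : K) :
    genFun Separable (weight 1 1 z) = genFun Separable (weight 1 z 1) := by
  rw [← gf₁_lmin]
  exact genFun_congr (fun _ _ => Iff.rfl) fun _ _ _ => by simp [weight]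

/-! ### The two- and three-variable series as Laurent series. -/

variable (z₁ z₂ z₃ : K)

theorem one_add_S_ne_zero [CharZero K] (z : K) : S z + 1 ≠ 0 := by
  rw [S_eq, ← map_one (HahnSeries.ofPowerSeries ℤ K), ← map_add]
  exact coe_ne_zero (by simp [constantCoeff_genFun_separable])

theorem one_sub_S_mul_S_ne_zero [CharZero K] (z z' : K) : 1 - S z * S z' ≠ 0 := by
  rw [S_eq, S_eq, ← map_one (HahnSeries.ofPowerSeries ℤ K), ← map_mul, ← map_sub]
  exact coe_ne_zero (by simp [constantCoeff_genFun_separable])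

theorem coe_redSeparable (z₁ z₂ z₃ : K) : (genFun RedSeparable (weight z₁ z₂ z₃) : K⸨X⸩)
    = (genFun IrrSeparable (weight z₁ 1 z₃) : K⸨X⸩)
      * (genFun Separable (weight z₁ z₂ 1) : K⸨X⸩) := by
  rw [genFun_redSeparable_weight, map_mul]

theorem coe_skewRed (z₁ z₂ z₃ : K) : (genFun SkewRed (weight z₁ z₂ z₃) : K⸨X⸩)
    = (genFun SkewIrr (weight z₁ z₂ z₃) : K⸨X⸩)
      * (genFun Separable (weight 1 z₂ z₃) : K⸨X⸩) := by
  rw [genFun_skewRed_weight, map_mul]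

theorem coe_separable (z₁ z₂ z₃ : K) : (genFun Separable (weight z₁ z₂ z₃) : K⸨X⸩)
    = (genFun RedSeparable (weight z₁ z₂ z₃) : K⸨X⸩)
      + (genFun IrrSeparable (weight z₁ z₂ z₃) : K⸨X⸩) := by
  rw [genFun_separable, map_add]

theorem coe_irrSeparable (z₁ z₂ z₃ : K) : (genFun IrrSeparable (weight z₁ z₂ z₃) : K⸨X⸩)
    = c z₁ * c z₂ * c z₃ * t + (genFun SkewRed (weight z₁ z₂ z₃) : K⸨X⸩) := by
  rw [genFun_irrSeparable, weight_one]
  simp only [map_add, map_mul, c, t]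

theorem coe_skewIrr (z₁ z₂ z₃ : K) : (genFun SkewIrr (weight z₁ z₂ z₃) : K⸨X⸩)
    = c z₁ * c z₂ * c z₃ * t + (genFun RedSeparable (weight z₁ z₂ z₃) : K⸨X⸩) := by
  rw [genFun_skewIrr, weight_one]
  simp only [map_add, map_mul, c, t]

theorem c_one : c (1 : K) = 1 := by simp only [c, map_one]

variable [CharZero K]

theorem coe_irrSeparable_lmax (z : K) :
    (genFun IrrSeparable (weight z 1 1) : K⸨X⸩) = S z / (S z + 1) := by
  have hR := coe_redSeparable z 1 1
  have hF := coe_separable z 1 1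
  rw [genFun_weight_lmax, ← S_eq] at hR hF
  rw [eq_div_iff (one_add_S_ne_zero z)]
  linear_combination -hF - hR

/-- With i = S(z₁)/(S(z₁)+1) the system gives F = (1 + S(z₂))(z₁z₂t + iF), which is linear in F. -/
theorem coe_separable_lmax_rmax : (genFun Separable (weight z₁ z₂ 1) : K⸨X⸩)
    = c z₁ * c z₂ * t * (S z₁ + 1) * (S z₂ + 1) / (1 - S z₁ * S z₂) := by
  have hR := coe_redSeparable z₁ z₂ 1
  have hQ := coe_skewRed z₁ z₂ 1
  have hF := coe_separable z₁ z₂ 1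
  have hI := coe_irrSeparable z₁ z₂ 1
  have hJ := coe_skewIrr z₁ z₂ 1
  have h := coe_irrSeparable_lmax z₁
  rw [eq_div_iff (one_add_S_ne_zero z₁)] at h
  rw [← S_eq] at hQ
  rw [c_one] at hI hJ
  rw [eq_div_iff (one_sub_S_mul_S_ne_zero z₁ z₂)]
  linear_combination (S z₁ + 1) * (hF + hI + hQ + hR) + (S z₁ + 1) * S z₂ * (hJ + hR)
    + (S z₂ + 1) * (genFun Separable (weight z₁ z₂ 1) : K⸨X⸩) * h

theorem coe_irrSeparable_lmax_lmin : (genFun IrrSeparable (weight z₁ 1 z₃) : K⸨X⸩)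
    = c z₁ * c z₃ * t * (S z₃ + 1) / (1 - S z₁ * S z₃) := by
  have hR := coe_redSeparable z₁ 1 z₃
  have hQ := coe_skewRed z₁ 1 z₃
  have hI := coe_irrSeparable z₁ 1 z₃
  have hJ := coe_skewIrr z₁ 1 z₃
  rw [genFun_weight_lmin, ← S_eq] at hQ
  rw [genFun_weight_lmax, ← S_eq] at hR
  rw [c_one] at hI hJ
  rw [eq_div_iff (one_sub_S_mul_S_ne_zero z₁ z₃)]
  linear_combination hI + hQ + S z₃ * (hJ + hR)

theorem E_eq : E z₁ z₂ z₃ = (genFun SkewIrr (weight z₁ z₂ z₃) : K⸨X⸩) := by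
  rw [coe_skewIrr, coe_redSeparable, coe_irrSeparable_lmax_lmin, coe_separable_lmax_rmax, E,
    div_mul_div_comm]
  congr 2
  ring

/-- The bracket in `A` is I(1,1,z₃) = z₃t + J(1,1,z₃) S(z₃), where J(1,1,z₃) = S(z₃)/(S(z₃)+1). -/
theorem A_add_eq : A z₂ z₃ + t * c z₂ * c z₃ = (genFun SkewIrr (weight 1 z₂ z₃) : K⸨X⸩) := by
  have hF := coe_separable 1 1 z₃
  have hQ := coe_skewRed 1 1 z₃
  have hI := coe_irrSeparable 1 1 z₃
  have hJ := coe_skewIrr 1 1 z₃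
  rw [genFun_weight_lmin, ← S_eq] at hF hQ
  have h : (genFun IrrSeparable (weight 1 1 z₃) : K⸨X⸩)
      = c z₃ * t + S z₃ ^ 2 / (S z₃ + 1) := by
    have hJS : (genFun SkewIrr (weight 1 1 z₃) : K⸨X⸩) = S z₃ / (S z₃ + 1) := by
      rw [eq_div_iff (one_add_S_ne_zero z₃)]
      linear_combination -hF - hI - hQ + hJ
    rw [hI, hQ, hJS, c_one]
    ring
  rw [coe_skewIrr, coe_redSeparable, h, ← S_eq, A, c_one]
  ring

theorem one_sub_A_sub_ne_zero : 1 - A z₂ z₃ - t * c z₂ * c z₃ ≠ 0 := by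
  rw [sub_sub, A_add_eq, ← map_one (HahnSeries.ofPowerSeries ℤ K), ← map_sub]
  refine coe_ne_zero ?_
  rw [map_sub, map_one, constantCoeff_genFun fun _ h => lt_irrefl _ h.1.pos, sub_zero]

/-- At z₁ = 1 the relation F = J(1 + F) involves a single F, so 1 + F is the geometric series 1/(1 -
J). -/
theorem one_add_coe_separable : 1 + (genFun Separable (weight 1 z₂ z₃) : K⸨X⸩)
    = 1 / (1 - A z₂ z₃ - t * c z₂ * c z₃) := by
  have hQ := coe_skewRed 1 z₂ z₃
  have hF := coe_separable 1 z₂ z₃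
  have hI := coe_irrSeparable 1 z₂ z₃
  have hJ := coe_skewIrr 1 z₂ z₃
  have hA := A_add_eq z₂ z₃
  rw [eq_div_iff (one_sub_A_sub_ne_zero z₂ z₃)]
  linear_combination hF + hI + hQ - hJ - (1 + (genFun Separable (weight 1 z₂ z₃) : K⸨X⸩)) * hA

theorem coe_redSeparable_eq : (genFun RedSeparable (weight z₁ z₂ z₃) : K⸨X⸩)
    = E z₁ z₂ z₃ - c z₁ * c z₂ * c z₃ * t := by
  rw [E_eq, coe_skewIrr, add_sub_cancel_left]

theorem coe_separable_eq : (genFun Separable (weight z₁ z₂ z₃) : K⸨X⸩)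
    = E z₁ z₂ z₃ / (1 - A z₂ z₃ - t * c z₂ * c z₃) := by
  rw [coe_separable, coe_redSeparable_eq, coe_irrSeparable, coe_skewRed, ← E_eq,
    div_eq_mul_one_div (E z₁ z₂ z₃), ← one_add_coe_separable]
  ring

theorem coe_irrSeparable_eq : (genFun IrrSeparable (weight z₁ z₂ z₃) : K⸨X⸩)
    = 1 / (1 - A z₂ z₃ - t * c z₂ * c z₃)
      * (c z₁ * c z₂ * c z₃ * t
        + (A z₂ z₃ + t * c z₂ * c z₃) * (E z₁ z₂ z₃ - c z₁ * c z₂ * c z₃ * t)) := by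
  have h : (genFun IrrSeparable (weight z₁ z₂ z₃) : K⸨X⸩)
      = E z₁ z₂ z₃ / (1 - A z₂ z₃ - t * c z₂ * c z₃)
        - (E z₁ z₂ z₃ - c z₁ * c z₂ * c z₃ * t) := by
    rw [← coe_separable_eq, ← coe_redSeparable_eq, coe_separable, add_sub_cancel_left]
  have h0 := one_sub_A_sub_ne_zero z₂ z₃
  rw [h]
  field_simp
  ring

end Algebra

/-! ### Transfer to the other triples of statistics. -/

section Symmetry

variable {K : Type*} [Field K] (z₁ z₂ z₃ : K)

/-- Complement and inverse do not commute, so the class is first described without the complement: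
separable, of length other than one, not reducible. -/
theorem skewRed_inv_iff (n : ℕ) (π : Equiv.Perm (Fin n)) : SkewRed n π⁻¹ ↔ SkewRed n π := by
  have h : ∀ π : Equiv.Perm (Fin n), SkewRed n π ↔ Separable n π ∧ n ≠ 1 ∧ ¬ Reducible n π := by
    intro π
    rw [SkewRed, RedSeparable, separable_comp_iff]
    refine and_congr_right fun hs => ⟨fun h => ⟨h.one_lt.ne', fun h' => h'.not_comp h⟩, fun h => ?_⟩
    exact (hs.trichotomy.resolve_left h.1).resolve_left h.2
  rw [h, h, separable_inv_iff, reducible_inv_iff]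

theorem skewIrr_inv_iff (n : ℕ) (π : Equiv.Perm (Fin n)) : SkewIrr n π⁻¹ ↔ SkewIrr n π := by
  have h : ∀ π : Equiv.Perm (Fin n),
      SkewIrr n π ↔ Separable n π ∧ (n = 1 ∨ Reducible n π) := by
    intro π
    rw [SkewIrr, IrrSeparable, separable_comp_iff]
    refine and_congr_right fun hs => ?_
    rw [hs.comp.irreducible_iff, comp_comp]
  rw [h, h, separable_inv_iff, reducible_inv_iff]

theorem gf₃_lmin_rmin_lmax (P : ∀ n : ℕ, Equiv.Perm (Fin n) → Prop) :
    gf₃ P lmin rmin lmax z₁ z₂ z₃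
      = genFun (fun n π => P n (comp π)) (weight z₁ z₂ z₃) :=
  gf₃_comp _ _ _ _ _ _ _ _ _ _ (fun _ => lmin_comp) (fun _ => rmin_comp) fun _ => lmax_comp

theorem gf₃_rmax_rmin_lmax (P : ∀ n : ℕ, Equiv.Perm (Fin n) → Prop)
    (hP : ∀ n (π : Equiv.Perm (Fin n)), P n (comp π⁻¹) ↔ P n (comp π)) :
    gf₃ P rmax rmin lmax z₁ z₂ z₃
      = genFun (fun n π => P n (comp π)) (weight z₁ z₂ z₃) := by
  rw [← gf₃_rmin_rmax_lmin _ _ _ hP]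
  exact gf₃_comp _ _ _ _ _ _ _ _ _ _ (fun _ => rmax_comp) (fun _ => rmin_comp) fun _ => lmax_comp

theorem separable_comp_eq :
    (fun (n : ℕ) (π : Equiv.Perm (Fin n)) => Separable n (comp π)) = Separable := by
  ext n π
  exact separable_comp_iff

theorem gf₃_separable {s₁ s₂ s₃ : Stat}
    (h : (s₁, s₂, s₃) ∈ ({(lmax, rmax, lmin), (lmin, rmin, lmax), (rmin, rmax, lmin),
      (rmax, rmin, lmax)} : Set (Stat × Stat × Stat))) :
    gf₃ Separable s₁ s₂ s₃ z₁ z₂ z₃ = genFun Separable (weight z₁ z₂ z₃) := by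
  simp only [Set.mem_insert_iff, Set.mem_singleton_iff, Prod.mk.injEq] at h
  rcases h with ⟨rfl, rfl, rfl⟩ | ⟨rfl, rfl, rfl⟩ | ⟨rfl, rfl, rfl⟩ | ⟨rfl, rfl, rfl⟩
  · rfl
  · rw [gf₃_lmin_rmin_lmax, separable_comp_eq]
  · exact gf₃_rmin_rmax_lmin _ _ _ fun _ _ => separable_inv_iff
  · rw [gf₃_rmax_rmin_lmax, separable_comp_eq]
    simp only [separable_comp_iff, separable_inv_iff, implies_true]

theorem gf₃_of_inv {P : ∀ n : ℕ, Equiv.Perm (Fin n) → Prop}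
    (hP : ∀ n (π : Equiv.Perm (Fin n)), P n π⁻¹ ↔ P n π) {s₁ s₂ s₃ : Stat}
    (h : (s₁, s₂, s₃) ∈ ({(lmax, rmax, lmin), (rmin, rmax, lmin)} : Set (Stat × Stat × Stat))) :
    gf₃ P s₁ s₂ s₃ z₁ z₂ z₃ = genFun P (weight z₁ z₂ z₃) := by
  simp only [Set.mem_insert_iff, Set.mem_singleton_iff, Prod.mk.injEq] at h
  rcases h with ⟨rfl, rfl, rfl⟩ | ⟨rfl, rfl, rfl⟩
  · rfl
  · exact gf₃_rmin_rmax_lmin _ _ _ hP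

theorem gf₃_of_comp_inv {P : ∀ n : ℕ, Equiv.Perm (Fin n) → Prop}
    (hP : ∀ n (π : Equiv.Perm (Fin n)), P n (comp π⁻¹) ↔ P n (comp π)) {s₁ s₂ s₃ : Stat}
    (h : (s₁, s₂, s₃) ∈ ({(lmin, rmin, lmax), (rmax, rmin, lmax)} : Set (Stat × Stat × Stat))) :
    gf₃ P s₁ s₂ s₃ z₁ z₂ z₃ = genFun (fun n π => P n (comp π)) (weight z₁ z₂ z₃) := by
  simp only [Set.mem_insert_iff, Set.mem_singleton_iff, Prod.mk.injEq] at h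
  rcases h with ⟨rfl, rfl, rfl⟩ | ⟨rfl, rfl, rfl⟩
  · exact gf₃_lmin_rmin_lmax _ _ _ _
  · exact gf₃_rmax_rmin_lmax _ _ _ _ hP

end Symmetry

end SepPerm

open SepPerm in
open scoped LaurentSeries in
theorem theorem6 {K : Type*} [Field K] [CharZero K] (z₁ z₂ z₃ : K) :
    -- the explicit series `S(t,z)` is the generating function of each single statistic
    (∀ s : Stat, s ∈ ({lmax, rmax, lmin, rmin} : Set Stat) → ∀ z : K,
      (gf₁ Separable s z : K⸨X⸩) = S z) ∧
    -- all separable permutations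
    (∀ s₁ s₂ s₃ : Stat,
      (s₁, s₂, s₃) ∈ ({(lmax, rmax, lmin), (lmin, rmin, lmax), (rmin, rmax, lmin),
        (rmax, rmin, lmax)} : Set (Stat × Stat × Stat)) →
      (gf₃ Separable s₁ s₂ s₃ z₁ z₂ z₃ : K⸨X⸩)
        = E z₁ z₂ z₃ / (1 - A z₂ z₃ - t * c z₂ * c z₃)) ∧
    -- reducible and irreducible separable permutations, first case
    (∀ s₁ s₂ s₃ : Stat,
      (s₁, s₂, s₃) ∈ ({(lmax, rmax, lmin), (rmin, rmax, lmin)} : Set (Stat × Stat × Stat)) →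
      (gf₃ RedSeparable s₁ s₂ s₃ z₁ z₂ z₃ : K⸨X⸩) = E z₁ z₂ z₃ - c z₁ * c z₂ * c z₃ * t ∧
      (gf₃ IrrSeparable s₁ s₂ s₃ z₁ z₂ z₃ : K⸨X⸩)
        = 1 / (1 - A z₂ z₃ - t * c z₂ * c z₃)
          * (c z₁ * c z₂ * c z₃ * t
            + (A z₂ z₃ + t * c z₂ * c z₃) * (E z₁ z₂ z₃ - c z₁ * c z₂ * c z₃ * t))) ∧
    -- reducible and irreducible separable permutations, second case
    (∀ s₁ s₂ s₃ : Stat,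
      (s₁, s₂, s₃) ∈ ({(lmin, rmin, lmax), (rmax, rmin, lmax)} : Set (Stat × Stat × Stat)) →
      (gf₃ IrrSeparable s₁ s₂ s₃ z₁ z₂ z₃ : K⸨X⸩) = E z₁ z₂ z₃ ∧
      (gf₃ RedSeparable s₁ s₂ s₃ z₁ z₂ z₃ : K⸨X⸩)
        = -(c z₁ * c z₂ * c z₃ * t)
          + 1 / (1 - A z₂ z₃ - t * c z₂ * c z₃)
            * (c z₁ * c z₂ * c z₃ * t
              + (A z₂ z₃ + t * c z₂ * c z₃) * (E z₁ z₂ z₃ - c z₁ * c z₂ * c z₃ * t))) := by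
  refine ⟨fun s hs z => coe_gf₁ hs z, fun s₁ s₂ s₃ h => ?_, fun s₁ s₂ s₃ h => ⟨?_, ?_⟩,
    fun s₁ s₂ s₃ h => ⟨?_, ?_⟩⟩
  · rw [gf₃_separable _ _ _ h, coe_separable_eq]
  · rw [gf₃_of_inv _ _ _ redSeparable_inv_iff h, coe_redSeparable_eq]
  · rw [gf₃_of_inv _ _ _ irrSeparable_inv_iff h, coe_irrSeparable_eq]
  · rw [gf₃_of_comp_inv _ _ _ skewIrr_inv_iff h, E_eq]
    rfl
  -- Complementation turns reducible permutations into skew sums, that is, irreducible ones other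
  -- than the permutation of length one; hence the term -z₁z₂z₃t.
  · rw [gf₃_of_comp_inv _ _ _ skewRed_inv_iff h, ← coe_irrSeparable_eq, coe_irrSeparable,
      neg_add_cancel_left]
    rfl
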